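/- For a finite-dimensional associative algebra $\mathfrak A$ over $\mathbb C$ and a linear functional $F\in\mathfrak A^*$ put $$\mathrm{Stab}_F(1)=\{a\in\mathfrak A : F(ax)-F(xa)=0 \text{ for all } x\in\mathfrak A\}.$$ The functional $F$ is called $1$-regular if $\dim \mathrm{Stab}_F(1)$ is the smallest possible among all linear functionals on $\mathfrak A$, and the index of $\mathfrak A$ is $\mathrm{ind}\,\mathfrak A:=\dim\mathrm{Stab}_F(1)$ for any $1$-regular $F$; that is, $\mathrm{ind}\,\mathfrak A=\min_{F\in\mathfrak A^*}\dim\mathrm{Stab}_F(1)$. Let $\mathfrak B$ be a finite-dimensional unital associative algebra over $\mathbb C$ with $\mathrm{ind}\,\mathfrak B=1$. Then for every integer $n\ge 0$, with $\mathrm{Mat}_n$ the algebra of complex $n\times n$ matrices, $$\mathrm{ind}\,(\mathrm{Mat}_n\otimes_{\mathbb C}\mathfrak B)=n.$$ -/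

import Mathlib

/-- For a linear functional `F` on an associative algebra `A` over `ℂ` and a scalar `α`, the space
`Stab_F(α)` of all `a : A` with `F (a x) - α F (x a) = 0` for every `x : A`. -/
def stab {A : Type*} [Ring A] [Algebra ℂ A] (F : Module.Dual ℂ A) (α : ℂ) : Submodule ℂ A where
  carrier := {a | ∀ x : A, F (a * x) - α * F (x * a) = 0}
  add_mem' := by
    intro a b ha hb x
    have h₁ := ha x
    have h₂ := hb x
    simp only [add_mul, mul_add, map_add]
    linear_combination h₁ + h₂
  zero_mem' := by
    intro x
    simp
  smul_mem' := by
    intro c a ha x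
    have h := ha x
    simp only [smul_mul_assoc, mul_smul_comm, map_smul, smul_eq_mul]
    linear_combination c * h

/-- `F` is `α`-regular: `Stab_F(α)` has the smallest dimension among all functionals on `A`. -/
def IsRegularFunctional {A : Type*} [Ring A] [Algebra ℂ A] (α : ℂ) (F : Module.Dual ℂ A) : Prop :=
  ∀ G : Module.Dual ℂ A, Module.finrank ℂ (stab F α) ≤ Module.finrank ℂ (stab G α)

/-- The index of a finite-dimensional associative algebra over `ℂ`: the smallest dimension of
`Stab_F(1)` over all linear functionals `F`, which is the dimension of `Stab_F(1)` for any
`1`-regular functional `F` (see the next two lemmas). -/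
noncomputable def algIndex (A : Type*) [Ring A] [Algebra ℂ A] : ℕ :=
  ⨅ F : Module.Dual ℂ A, Module.finrank ℂ (stab F 1)

theorem algIndex_eq_of_isRegularFunctional {A : Type*} [Ring A] [Algebra ℂ A]
    {F : Module.Dual ℂ A} (hF : IsRegularFunctional 1 F) :
    algIndex A = Module.finrank ℂ (stab F 1) :=
  le_antisymm (ciInf_le (OrderBot.bddBelow _) F) (le_ciInf hF)

theorem exists_isRegularFunctional (A : Type*) [Ring A] [Algebra ℂ A] :
    ∃ F : Module.Dual ℂ A, IsRegularFunctional 1 F := by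
  obtain ⟨F, hF⟩ := ciInf_mem (fun F : Module.Dual ℂ A => Module.finrank ℂ (stab F 1))
  refine ⟨F, fun G => ?_⟩
  have h : Module.finrank ℂ (stab F 1) = algIndex A := hF
  rw [h]
  exact ciInf_le (OrderBot.bddBelow _) G

/-! Choose `F` on `B` with scalar stabilizer and `F 1 ≠ 0`. For `diagFunctional F n d` the
stabilizer splits over matrix entries into twisted stabilizers `stab F (d k / d l)`; for generic `d`
the off-diagonal ones vanish (`exists_finite_stab_eq_bot`), leaving the scalar diagonal matrices, of
dimension `n`. This bounds the index above. For the lower bound, the diagonal family is transversal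
at `d` to the conjugation orbit, so every functional near that point is conjugate to a member of the
family (`eventually_exists_conj`), and every member is stabilized by the scalar diagonals.
Semicontinuity along a line carries the bound `n` to an arbitrary functional
(`le_finrank_stab_of_transversal`). -/

/-- The bilinear form `(a, x) ↦ F (a x) - α F (x a)`, whose left kernel is `stab F α`. -/
noncomputable def twistedForm {A : Type*} [Ring A] [Algebra ℂ A] (F : Module.Dual ℂ A) (α : ℂ) :
    A →ₗ[ℂ] Module.Dual ℂ A :=
  (LinearMap.mul ℂ A).compr₂ F - α • (LinearMap.mul ℂ A).flip.compr₂ F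

@[simp]
theorem twistedForm_apply {A : Type*} [Ring A] [Algebra ℂ A] (F : Module.Dual ℂ A) (α : ℂ)
    (a x : A) : twistedForm F α a x = F (a * x) - α * F (x * a) := by
  simp [twistedForm]

theorem mem_stab {A : Type*} [Ring A] [Algebra ℂ A] {F : Module.Dual ℂ A} {α : ℂ} {a : A} :
    a ∈ stab F α ↔ ∀ x : A, F (a * x) - α * F (x * a) = 0 := Iff.rfl

theorem mem_stab_one {A : Type*} [Ring A] [Algebra ℂ A] {F : Module.Dual ℂ A} {a : A} :
    a ∈ stab F 1 ↔ ∀ x : A, F (a * x) = F (x * a) := by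
  simp [mem_stab, sub_eq_zero]

theorem one_mem_stab_one {A : Type*} [Ring A] [Algebra ℂ A] (F : Module.Dual ℂ A) :
    (1 : A) ∈ stab F 1 := mem_stab_one.2 fun x => by simp

theorem algIndex_le {A : Type*} [Ring A] [Algebra ℂ A] (F : Module.Dual ℂ A) :
    algIndex A ≤ Module.finrank ℂ (stab F 1) :=
  ciInf_le (OrderBot.bddBelow _) F

/-! ### Linear pencils and semicontinuity of the stabilizer -/

/-- In a linear pencil `T + t S` with `T` injective, all but finitely many members are injective. -/
theorem finite_setOf_not_injective_pencil {K V W : Type*} [Field K] [AddCommGroup V] [Module K V]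
    [AddCommGroup W] [Module K W] [FiniteDimensional K W] (T S : W →ₗ[K] V)
    (hT : Function.Injective T) : {t : K | ¬ Function.Injective (T + t • S)}.Finite := by
  obtain ⟨P, hP⟩ := T.exists_leftInverse_of_injective (LinearMap.ker_eq_bot.2 hT)
  -- A kernel vector `w` of `T + t S` satisfies `w + t P S w = 0`, so `-t⁻¹` is an eigenvalue of `P
  -- ∘ S`.
  refine ((Module.End.finite_hasEigenvalue (P ∘ₗ S)).image fun μ => -μ⁻¹).subset fun t ht => ?_
  rw [Set.mem_ofPred_eq, ← LinearMap.ker_eq_bot, Submodule.eq_bot_iff] at ht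
  push Not at ht
  obtain ⟨w, hw, hw0⟩ := ht
  have h : w + t • P (S w) = 0 := by
    have h₁ := congrArg P (LinearMap.mem_ker.1 hw)
    have h₂ : P (T w) = w := LinearMap.congr_fun hP w
    simpa [h₂] using h₁
  have ht0 : t ≠ 0 := by
    rintro rfl
    exact hw0 (by simpa using h)
  refine ⟨-t⁻¹, ?_, by simp⟩
  refine Module.End.hasEigenvalue_of_hasEigenvector (x := w)
    ⟨Module.End.mem_eigenspace_iff.2 ?_, hw0⟩
  have h₃ : t • P (S w) = -w := by rw [eq_neg_iff_add_eq_zero, add_comm, h]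
  rw [LinearMap.comp_apply, ← inv_smul_smul₀ ht0 (P (S w)), h₃, smul_neg, neg_smul]

/-- On a complement of `stab G 1` the form of `G` is injective, hence so is that of `G + t H` for
almost all `t`, whose stabilizer then misses the complement. -/
theorem finite_setOf_finrank_stab_lt {A : Type*} [Ring A] [Algebra ℂ A] [FiniteDimensional ℂ A]
    (G H : Module.Dual ℂ A) :
    {t : ℂ | Module.finrank ℂ (stab G 1) < Module.finrank ℂ (stab (G + t • H) 1)}.Finite := by
  obtain ⟨W, hW⟩ := (stab G 1).exists_isCompl
  refine (finite_setOf_not_injective_pencil ((twistedForm G 1).domRestrict W)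
    ((twistedForm H 1).domRestrict W) ?_).subset fun t ht hinj => ?_
  · rw [← LinearMap.ker_eq_bot, Submodule.eq_bot_iff]
    rintro ⟨w, hwW⟩ hw
    have hs : w ∈ stab G 1 := fun x => by
      simpa using LinearMap.congr_fun (LinearMap.mem_ker.1 hw) x
    exact Subtype.ext (Submodule.disjoint_def.1 hW.disjoint w hs hwW)
  · have hd : Disjoint (stab (G + t • H) 1) W := by
      rw [Submodule.disjoint_def]
      intro w hw hwW
      refine congrArg Subtype.val (hinj (a₁ := ⟨w, hwW⟩) (a₂ := 0) ?_)
      rw [map_zero]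
      ext x
      have h := mem_stab.1 hw x
      simp only [LinearMap.add_apply, LinearMap.smul_apply, smul_eq_mul] at h
      simp only [LinearMap.add_apply, LinearMap.smul_apply, smul_eq_mul,
        LinearMap.domRestrict_apply, twistedForm_apply, LinearMap.zero_apply]
      linear_combination h
    have h₁ := Submodule.finrank_add_finrank_le_of_disjoint hd
    have h₂ := Submodule.finrank_add_eq_of_isCompl hW
    have h₃ : Module.finrank ℂ (stab G 1) < Module.finrank ℂ (stab (G + t • H) 1) := ht
    omega

/-- Twisted stabilizers `stab F α` are trivial for all but finitely many `α ≠ 1`, if `stab F 1`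
consists of scalars only and `F 1 ≠ 0`. -/
theorem exists_finite_stab_eq_bot {B : Type*} [Ring B] [Algebra ℂ B] [FiniteDimensional ℂ B]
    {F : Module.Dual ℂ B} (hF : stab F 1 = ℂ ∙ (1 : B)) (hF1 : F 1 ≠ 0) :
    ∃ s : Set ℂ, s.Finite ∧ ∀ α, α ∉ s → α ≠ 1 → stab F α = ⊥ := by
  -- The `α`-form is the `1`-form plus `(α - 1) S`. Pairing with `1` puts `stab F α` inside `ker F`
  -- when `α ≠ 1`, and `ker F` contains no nonzero scalar.
  let S : LinearMap.ker F →ₗ[ℂ] Module.Dual ℂ B :=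
    (-(LinearMap.mul ℂ B).flip.compr₂ F).domRestrict (LinearMap.ker F)
  have hfin := finite_setOf_not_injective_pencil
    ((twistedForm F 1).domRestrict (LinearMap.ker F)) S ?_
  · refine ⟨_, hfin.image (1 + ·), fun α hα hα1 => ?_⟩
    have hinj : Function.Injective ((twistedForm F 1).domRestrict (LinearMap.ker F) +
        (α - 1) • S) := by
      by_contra h
      exact hα ⟨α - 1, h, by ring⟩
    rw [Submodule.eq_bot_iff]
    intro a ha
    have haF : F a = 0 := by
      have h := mem_stab.1 ha 1
      rw [mul_one, one_mul] at h
      have h' : (1 - α) * F a = 0 := by linear_combination h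
      exact (mul_eq_zero.1 h').resolve_left (sub_ne_zero.2 hα1.symm)
    refine congrArg Subtype.val (hinj (a₁ := ⟨a, haF⟩) (a₂ := 0) ?_)
    rw [map_zero]
    ext x
    have h := mem_stab.1 ha x
    simp only [S, LinearMap.add_apply, LinearMap.smul_apply, smul_eq_mul, LinearMap.neg_apply,
      LinearMap.domRestrict_apply, twistedForm_apply, LinearMap.zero_apply,
      LinearMap.compr₂_apply, LinearMap.flip_apply, LinearMap.mul_apply']
    linear_combination h
  · rw [← LinearMap.ker_eq_bot, Submodule.eq_bot_iff]
    rintro ⟨w, hwF⟩ hw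
    have hs : w ∈ stab F 1 := fun x => by
      simpa using LinearMap.congr_fun (LinearMap.mem_ker.1 hw) x
    rw [hF, Submodule.mem_span_singleton] at hs
    obtain ⟨c, rfl⟩ := hs
    have hc : c * F 1 = 0 := by simpa using hwF
    have hc0 : c = 0 := (mul_eq_zero.1 hc).resolve_right hF1
    ext
    simp [hc0]

/-- If the index of `B` is one, a regular functional can be corrected by the trace of the regular
representation so as not to vanish at `1`. -/
theorem exists_stab_eq_span_one {B : Type*} [Ring B] [Algebra ℂ B] [FiniteDimensional ℂ B]
    (hB : algIndex B = 1) :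
    ∃ F : Module.Dual ℂ B, stab F 1 = ℂ ∙ (1 : B) ∧ F 1 ≠ 0 := by
  obtain ⟨F₀, hF₀⟩ := exists_isRegularFunctional B
  have h₀ : Module.finrank ℂ (stab F₀ 1) = 1 := by
    rw [← algIndex_eq_of_isRegularFunctional hF₀, hB]
  have : Nontrivial B := by
    by_contra h
    rw [not_nontrivial_iff_subsingleton] at h
    have := Module.finrank_zero_of_subsingleton (R := ℂ) (M := stab F₀ 1)
    omega
  have hs (F : Module.Dual ℂ B) (hF : stab F 1 = stab F₀ 1) : stab F 1 = ℂ ∙ (1 : B) := by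
    refine (Submodule.eq_of_le_of_finrank_le ?_ ?_).symm
    · simpa [Submodule.span_le] using one_mem_stab_one F
    · rw [hF, h₀, finrank_span_singleton one_ne_zero]
  by_cases h1 : F₀ 1 = 0
  · let τ : Module.Dual ℂ B := LinearMap.trace ℂ B ∘ₗ (Algebra.lmul ℂ B).toLinearMap
    have hτa (a : B) : τ a = LinearMap.trace ℂ B (Algebra.lmul ℂ B a) := rfl
    have hτ (a x : B) : τ (a * x) = τ (x * a) := by
      rw [hτa, hτa, map_mul (Algebra.lmul ℂ B), map_mul (Algebra.lmul ℂ B),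
        LinearMap.trace_mul_comm]
    refine ⟨F₀ + τ, hs _ ?_, ?_⟩
    · ext a
      simp [mem_stab_one, hτ]
    · rw [LinearMap.add_apply, h1, zero_add, hτa, map_one (Algebra.lmul ℂ B),
        LinearMap.trace_one, Nat.cast_ne_zero]
      exact Module.finrank_pos.ne'
  · exact ⟨F₀, hs _ rfl, h1⟩

theorem exists_forall_div_notMem {s : Set ℂ} (hs : s.Finite) (n : ℕ) :
    ∃ d : Fin n → ℂ, (∀ k, d k ≠ 0) ∧
      ∀ k l, k ≠ l → d k / d l ≠ 1 ∧ d k / d l ∉ s := by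
  have h0 (k : Fin n) : Filter.Tendsto (fun δ : ℂ => 1 + (k : ℂ) * δ) (nhdsWithin 0 {0}ᶜ)
      (nhds 1) := by
    have h : Continuous fun δ : ℂ => 1 + (k : ℂ) * δ := by fun_prop
    simpa using (h.tendsto 0).mono_left nhdsWithin_le_nhds
  have h1 : ∀ᶠ δ : ℂ in nhdsWithin 0 {0}ᶜ, ∀ k : Fin n, 1 + (k : ℂ) * δ ≠ 0 :=
    Filter.eventually_all.2 fun k => (h0 k).eventually_ne one_ne_zero
  -- The ratios tend to `1`, so `1` itself must be removed from `s`.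
  have h2 : ∀ᶠ δ : ℂ in nhdsWithin 0 {0}ᶜ, ∀ k l : Fin n,
      (1 + (k : ℂ) * δ) / (1 + (l : ℂ) * δ) ∉ s \ {1} := by
    refine Filter.eventually_all.2 fun k => Filter.eventually_all.2 fun l => ?_
    have h := (h0 k).div (h0 l) one_ne_zero
    rw [div_one] at h
    exact h.eventually ((hs.subset Set.sdiff_subset).isClosed.isOpen_compl.mem_nhds (by simp))
  obtain ⟨δ, h1, h2, hδ⟩ := (h1.and (h2.and self_mem_nhdsWithin)).exists
  refine ⟨fun k => 1 + (k : ℂ) * δ, h1, fun k l hkl => ?_⟩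
  have hne : (1 + (k : ℂ) * δ) / (1 + (l : ℂ) * δ) ≠ 1 := by
    rw [Ne, div_eq_one_iff_eq (h1 l), add_right_inj, mul_left_inj' hδ, Nat.cast_inj]
    exact fun h => hkl (Fin.ext h)
  exact ⟨hne, fun h => h2 k l ⟨h, hne⟩⟩

/-! ### Conjugation and transversality -/

theorem finrank_stab_le_of_conj {A : Type*} [Ring A] [Algebra ℂ A] [FiniteDimensional ℂ A]
    {F G : Module.Dual ℂ A} (u : Aˣ) (h : ∀ x, G x = F (u * x * ↑u⁻¹)) :
    Module.finrank ℂ (stab F 1) ≤ Module.finrank ℂ (stab G 1) := by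
  let c : A →ₗ[ℂ] A := LinearMap.mulLeftRight ℂ (↑u⁻¹, ↑u)
  have hc : ∀ a ∈ stab F 1, c a ∈ stab G 1 := by
    intro a ha
    rw [mem_stab_one] at ha ⊢
    intro x
    have h₁ := ha (u * x * ↑u⁻¹)
    simpa [c, h, mul_assoc] using h₁
  refine LinearMap.finrank_le_finrank_of_injective (f := c.restrict hc) ?_
  rintro ⟨a, ha⟩ ⟨b, hb⟩ hab
  simpa [c] using congrArg Subtype.val hab

/-- Functionals near a member of a linear family transversal to its orbit under conjugation are
conjugate to members of the family. -/
theorem eventually_exists_conj {A : Type*} [NormedRing A] [NormedAlgebra ℂ A]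
    [FiniteDimensional ℂ A] {E : Type*} [NormedAddCommGroup E] [NormedSpace ℂ E]
    [FiniteDimensional ℂ E] (L : E →ₗ[ℂ] Module.Dual ℂ A) (e₀ : E)
    (hL : ∀ x ∈ stab (L e₀) 1, (∀ e, L e x = 0) → x = 0) (H : Module.Dual ℂ A) :
    ∀ᶠ t : ℂ in nhds 0, ∃ (u : Aˣ) (e : E), ∀ x, (L e₀ + t • H) x = L e (u * x * ↑u⁻¹) := by
  have : CompleteSpace A := FiniteDimensional.complete ℂ A
  have : CompleteSpace E := FiniteDimensional.complete ℂ E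
  let Lc : E →L[ℂ] A →L[ℂ] ℂ := LinearMap.toContinuousLinearMap
    ((LinearMap.toContinuousLinearMap : (A →ₗ[ℂ] ℂ) ≃ₗ[ℂ] _).toLinearMap ∘ₗ L)
  have hLc (e : E) (x : A) : Lc e x = L e x := rfl
  clear_value Lc
  let Φ : A × E → A →L[ℂ] ℂ := fun p =>
    (Lc p.2).comp (ContinuousLinearMap.mulLeftRight ℂ A p.1 (Ring.inverse p.1))
  have hfst : HasStrictFDerivAt (Prod.fst : A × E → A) (ContinuousLinearMap.fst ℂ A E) (1, e₀) :=
    hasStrictFDerivAt_fst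
  have hinv : HasStrictFDerivAt (fun p : A × E => Ring.inverse p.1) _ (1, e₀) :=
    HasStrictFDerivAt.comp (1, e₀) (g := Ring.inverse)
      (hasStrictFDerivAt_ringInverse (𝕜 := ℂ) (1 : Aˣ)) hfst
  have hleft : HasStrictFDerivAt (fun p : A × E => ContinuousLinearMap.mulLeftRight ℂ A p.1)
      ((ContinuousLinearMap.mulLeftRight ℂ A).comp (ContinuousLinearMap.fst ℂ A E)) (1, e₀) :=
    ((ContinuousLinearMap.mulLeftRight ℂ A).comp
      (ContinuousLinearMap.fst ℂ A E)).hasStrictFDerivAt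
  have hfamily : HasStrictFDerivAt (fun p : A × E => Lc p.2)
      (Lc.comp (ContinuousLinearMap.snd ℂ A E)) (1, e₀) :=
    (Lc.comp (ContinuousLinearMap.snd ℂ A E)).hasStrictFDerivAt
  obtain ⟨Φ', hΦ, hΦ'⟩ : ∃ Φ' : A × E →L[ℂ] A →L[ℂ] ℂ, HasStrictFDerivAt Φ Φ' (1, e₀) ∧
      ∀ a e x, Φ' (a, e) x = L e₀ (a * x) - L e₀ (x * a) + L e x := by
    refine ⟨_, hfamily.clm_comp (hleft.clm_apply hinv), fun a e x => ?_⟩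
    simp [hLc, sub_eq_add_neg, add_comm]
  have hsurj := hΦ.map_nhds_eq_of_surj ?_
  · have hΦ1 : Φ (1, e₀) = Lc e₀ := by
      ext x
      simp [Φ]
    rw [hΦ1] at hsurj
    have hunit : ∀ᶠ p : A × E in nhds (1, e₀), IsUnit p.1 :=
      (continuous_fst.tendsto ((1 : A), e₀)).eventually (Units.isOpen.mem_nhds isUnit_one)
    have hnear : ∀ᶠ G : A →L[ℂ] ℂ in nhds (Lc e₀), ∃ p : A × E, IsUnit p.1 ∧ Φ p = G := by
      rw [← hsurj, Filter.eventually_map]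
      exact hunit.mono fun p hp => ⟨p, hp, rfl⟩
    obtain ⟨Hc, hHc⟩ : ∃ Hc : A →L[ℂ] ℂ, ∀ x, Hc x = H x :=
      ⟨LinearMap.toContinuousLinearMap H, fun _ => rfl⟩
    have hcont : Continuous fun t : ℂ => Lc e₀ + t • Hc := by fun_prop
    have h0 : Filter.Tendsto (fun t : ℂ => Lc e₀ + t • Hc) (nhds 0) (nhds (Lc e₀)) := by
      have hzero : Lc e₀ + (0 : ℂ) • Hc = Lc e₀ := by
        ext x
        simp
      have h := hcont.tendsto 0
      rwa [hzero] at h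
    filter_upwards [h0.eventually hnear] with t ht
    obtain ⟨⟨_, e⟩, ⟨u, rfl⟩, hp⟩ := ht
    refine ⟨u, e, fun x => ?_⟩
    have h := DFunLike.congr_fun hp x
    simpa [Φ, hLc, hHc] using h.symm
  -- A functional killing the range of the derivative is evaluation at some `x`; orbit directions
  -- put `x` in the stabilizer, family directions make the family vanish on it, so `x = 0`.
  · by_contra hne
    obtain ⟨ψ, hψ0, hψ⟩ := Submodule.exists_le_ker_of_lt_top _ (lt_top_iff_ne_top.2 hne)
    obtain ⟨x, hx⟩ := (Module.evalEquiv ℂ A).surjective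
      (ψ ∘ₗ (LinearMap.toContinuousLinearMap : (A →ₗ[ℂ] ℂ) ≃ₗ[ℂ] _).toLinearMap)
    have hψx (f : A →L[ℂ] ℂ) : ψ f = f x := by
      have h := LinearMap.congr_fun hx (f : A →ₗ[ℂ] ℂ)
      exact h.symm
    have hker (a : A) (e : E) : L e₀ (a * x) - L e₀ (x * a) + L e x = 0 := by
      have h := LinearMap.mem_ker.1 (hψ (LinearMap.mem_range_self _ (a, e)))
      rwa [hψx, ContinuousLinearMap.coe_coe, hΦ'] at h
    have hx0 : x = 0 := by
      refine hL x (mem_stab_one.2 fun a => ?_) fun e => ?_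
      · have h := hker a 0
        simp only [map_zero, LinearMap.zero_apply, add_zero, sub_eq_zero] at h
        exact h.symm
      · simpa using hker 0 e
    exact hψ0 (LinearMap.ext fun f => by simp [hψx, hx0])

theorem le_finrank_stab_of_transversal {A : Type*} [Ring A] [Algebra ℂ A]
    [FiniteDimensional ℂ A] {E : Type*} [NormedAddCommGroup E] [NormedSpace ℂ E]
    [FiniteDimensional ℂ E] (L : E →ₗ[ℂ] Module.Dual ℂ A) (e₀ : E)
    (hL : ∀ x ∈ stab (L e₀) 1, (∀ e, L e x = 0) → x = 0) {n : ℕ}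
    (hn : ∀ e, n ≤ Module.finrank ℂ (stab (L e) 1)) (G : Module.Dual ℂ A) :
    n ≤ Module.finrank ℂ (stab G 1) := by
  let b := Module.finBasis ℂ A
  -- Any algebra norm will do; this one comes from the left regular representation.
  let _ : NormedRing (Matrix (Fin (Module.finrank ℂ A)) (Fin (Module.finrank ℂ A)) ℂ) :=
    Matrix.linftyOpNormedRing
  let _ : NormedAlgebra ℂ (Matrix (Fin (Module.finrank ℂ A)) (Fin (Module.finrank ℂ A)) ℂ) :=
    Matrix.linftyOpNormedAlgebra
  let _ : NormedRing A := NormedRing.induced A _ (Algebra.leftMulMatrix b)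
    (Algebra.leftMulMatrix_injective b)
  let _ : NormedAlgebra ℂ A := NormedAlgebra.induced ℂ A _ (Algebra.leftMulMatrix b)
  have hnear := eventually_exists_conj L e₀ hL (G - L e₀)
  -- On the line through `L e₀` and `G`, the generic dimension is at least `n` and at most that at `G`.
  have hgen : ∀ᶠ t : ℂ in nhdsWithin 0 {0}ᶜ,
      1 - t ∉ {s : ℂ | Module.finrank ℂ (stab G 1) <
        Module.finrank ℂ (stab (G + s • (L e₀ - G)) 1)} := by
    have hfin := (finite_setOf_finrank_stab_lt G (L e₀ - G)).image (1 - ·)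
    have h := (hfin.subset (Set.sdiff_subset (t := {0}))).isClosed.isOpen_compl.mem_nhds
      (x := (0 : ℂ)) (by simp)
    filter_upwards [mem_nhdsWithin_of_mem_nhds h, self_mem_nhdsWithin] with t ht ht0 hmem
    exact ht ⟨⟨1 - t, hmem, by ring⟩, ht0⟩
  obtain ⟨t, ⟨u, e, hu⟩, ht⟩ := ((hnear.filter_mono nhdsWithin_le_nhds).and hgen).exists
  have hline : G + (1 - t) • (L e₀ - G) = L e₀ + t • (G - L e₀) := by module
  rw [Set.mem_ofPred_eq, not_lt, hline] at ht
  exact (hn e).trans ((finrank_stab_le_of_conj u hu).trans ht)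

theorem AlgEquiv.algIndex_le {A A' : Type*} [Ring A] [Algebra ℂ A] [Ring A'] [Algebra ℂ A']
    (φ : A ≃ₐ[ℂ] A') : algIndex A ≤ algIndex A' := by
  refine le_ciInf fun F => ?_
  refine (_root_.algIndex_le (F ∘ₗ φ.toLinearMap)).trans_eq ?_
  have h : stab F 1 = (stab (F ∘ₗ φ.toLinearMap) 1).map (φ.toLinearEquiv : A →ₗ[ℂ] A') := by
    ext a
    rw [Submodule.mem_map_equiv, mem_stab_one, mem_stab_one]
    refine ⟨fun h x => by simpa using h (φ x), fun h x => by simpa using h (φ.symm x)⟩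
  rw [h, LinearEquiv.finrank_map_eq]

theorem AlgEquiv.algIndex_eq {A A' : Type*} [Ring A] [Algebra ℂ A] [Ring A'] [Algebra ℂ A']
    (φ : A ≃ₐ[ℂ] A') : algIndex A = algIndex A' :=
  le_antisymm φ.algIndex_le φ.symm.algIndex_le

/-! ### Diagonal functionals on matrices -/

/-- The functional `X ↦ ∑ k, d k * F (X k k)` on matrices, linear in `d`. -/
noncomputable def diagFunctional {B : Type*} [Ring B] [Algebra ℂ B] (F : Module.Dual ℂ B) (n : ℕ) :
    (Fin n → ℂ) →ₗ[ℂ] Module.Dual ℂ (Matrix (Fin n) (Fin n) B) :=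
  ∑ k, (LinearMap.proj k : (Fin n → ℂ) →ₗ[ℂ] ℂ).smulRight (F ∘ₗ Matrix.entryLinearMap ℂ B k k)

theorem diagFunctional_apply {B : Type*} [Ring B] [Algebra ℂ B] (F : Module.Dual ℂ B) {n : ℕ}
    (d : Fin n → ℂ) (X : Matrix (Fin n) (Fin n) B) :
    diagFunctional F n d X = ∑ k, d k * F (X k k) := by
  simp [diagFunctional, LinearMap.sum_apply]

/-- Testing against matrix units decouples the entries. -/
theorem mem_stab_diagFunctional {B : Type*} [Ring B] [Algebra ℂ B] {F : Module.Dual ℂ B} {n : ℕ}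
    {d : Fin n → ℂ} {a : Matrix (Fin n) (Fin n) B} :
    a ∈ stab (diagFunctional F n d) 1 ↔
      ∀ k l y, d l * F (a l k * y) = d k * F (y * a l k) := by
  rw [mem_stab_one]
  constructor
  · intro h k l y
    have h := h (Matrix.single k l y)
    rw [diagFunctional_apply, diagFunctional_apply, Finset.sum_eq_single l, Finset.sum_eq_single k]
      at h
    · simpa using h
    · intro i _ hi
      simp [Matrix.single_mul_apply_of_ne, hi]
    · simp
    · intro i _ hi
      simp [Matrix.mul_single_apply_of_ne, hi]
    · simp
  · intro h x
    simp only [diagFunctional_apply, Matrix.mul_apply, map_sum, Finset.mul_sum]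
    rw [Finset.sum_comm]
    exact Finset.sum_congr rfl fun k _ => Finset.sum_congr rfl fun l _ => h k l _

theorem diagonal_mem_stab_diagFunctional {B : Type*} [Ring B] [Algebra ℂ B]
    (F : Module.Dual ℂ B) {n : ℕ} (d c : Fin n → ℂ) :
    Matrix.diagonal (fun k => c k • (1 : B)) ∈ stab (diagFunctional F n d) 1 := by
  refine mem_stab_diagFunctional.2 fun k l y => ?_
  obtain rfl | hkl := eq_or_ne l k
  · simp
  · simp [hkl]

/-- Diagonal matrices with scalar entries. -/
noncomputable def scalarDiagonal (B : Type*) [Ring B] [Algebra ℂ B] (n : ℕ) :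
    (Fin n → ℂ) →ₗ[ℂ] Matrix (Fin n) (Fin n) B :=
  Matrix.diagonalLinearMap (Fin n) ℂ B ∘ₗ LinearMap.pi fun k =>
    (LinearMap.proj k : (Fin n → ℂ) →ₗ[ℂ] ℂ).smulRight (1 : B)

theorem scalarDiagonal_apply {B : Type*} [Ring B] [Algebra ℂ B] {n : ℕ} (c : Fin n → ℂ) :
    scalarDiagonal B n c = Matrix.diagonal fun k => c k • (1 : B) := rfl

theorem finrank_range_scalarDiagonal (B : Type*) [Ring B] [Algebra ℂ B] [Nontrivial B] (n : ℕ) :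
    Module.finrank ℂ (LinearMap.range (scalarDiagonal B n)) = n := by
  rw [LinearMap.finrank_range_of_inj, Module.finrank_fin_fun]
  intro c c' h
  ext k
  have h := congrFun (congrFun h k) k
  simp only [scalarDiagonal_apply, Matrix.diagonal_apply_eq] at h
  exact smul_left_injective ℂ one_ne_zero h

theorem range_scalarDiagonal_le_stab {B : Type*} [Ring B] [Algebra ℂ B]
    (F : Module.Dual ℂ B) {n : ℕ} (d : Fin n → ℂ) :
    LinearMap.range (scalarDiagonal B n) ≤ stab (diagFunctional F n d) 1 := by
  rintro _ ⟨c, rfl⟩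
  exact diagonal_mem_stab_diagFunctional F d c

theorem algIndex_matrix {B : Type*} [Ring B] [Algebra ℂ B] [FiniteDimensional ℂ B]
    (hB : algIndex B = 1) (n : ℕ) : algIndex (Matrix (Fin n) (Fin n) B) = n := by
  obtain ⟨F, hF, hF1⟩ := exists_stab_eq_span_one hB
  have : Nontrivial B := ⟨1, 0, fun h => hF1 (by rw [h, map_zero])⟩
  obtain ⟨s, hs, hstab⟩ := exists_finite_stab_eq_bot hF hF1
  obtain ⟨d, hd0, hd⟩ := exists_forall_div_notMem hs n
  have hgen : stab (diagFunctional F n d) 1 = LinearMap.range (scalarDiagonal B n) := by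
    refine le_antisymm (fun a ha => ?_) (range_scalarDiagonal_le_stab F d)
    rw [mem_stab_diagFunctional] at ha
    have hmem (k l : Fin n) : a l k ∈ stab F (d k / d l) := fun y => by
      field_simp [hd0 l]
      linear_combination ha k l y
    have hdiag (k : Fin n) : ∃ c : ℂ, c • (1 : B) = a k k := by
      have h := hmem k k
      rwa [div_self (hd0 k), hF, Submodule.mem_span_singleton] at h
    choose c hc using hdiag
    refine ⟨c, ?_⟩
    ext l k
    rw [scalarDiagonal_apply]
    obtain rfl | hlk := eq_or_ne l k
    · rw [Matrix.diagonal_apply_eq, hc]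
    · have h := hmem k l
      rw [hstab _ (hd k l hlk.symm).2 (hd k l hlk.symm).1, Submodule.mem_bot] at h
      rw [Matrix.diagonal_apply_ne _ hlk, h]
  apply le_antisymm
  · refine (algIndex_le (diagFunctional F n d)).trans_eq ?_
    rw [hgen, finrank_range_scalarDiagonal]
  · refine le_ciInf fun G => le_finrank_stab_of_transversal (diagFunctional F n) d ?_ ?_ G
    · intro x hx hx0
      rw [hgen] at hx
      obtain ⟨c, rfl⟩ := hx
      have hc : c = 0 := by
        ext k
        -- The `k`-th coordinate functional takes the value `c k * F 1` here, which is where `F 1 ≠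
        -- 0` gives transversality.
        have h := hx0 (Pi.single k 1)
        rw [diagFunctional_apply, Finset.sum_eq_single k (by simp +contextual) (by simp)] at h
        simpa [scalarDiagonal_apply, hF1] using h
      rw [hc, map_zero]
    · intro e
      exact (finrank_range_scalarDiagonal B n).symm.le.trans
        (Submodule.finrank_mono (range_scalarDiagonal_le_stab F e))

open scoped TensorProduct in
theorem corollary2 {B : Type*} [Ring B] [Algebra ℂ B] [FiniteDimensional ℂ B]
    (hB : algIndex B = 1) (n : ℕ) :
    algIndex (Matrix (Fin n) (Fin n) ℂ ⊗[ℂ] B) = n := by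
  let φ := (Algebra.TensorProduct.comm ℂ (Matrix (Fin n) (Fin n) ℂ) B).trans
    (matrixEquivTensor (Fin n) ℂ B).symm
  exact φ.algIndex_eq.trans (algIndex_matrix hB n)
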